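/- Let $a<b$ and $A$ be real numbers, and let $V:\mathbb R\to\mathbb R$ be a $C^2$ function such that $V'$ and $V''$ do not vanish simultaneously. For $\theta\in C^1([a,b])$ put $$\mathscr E[\theta]=\int_a^b\Big(\tfrac12(\theta'(s)-A)^2-V(\theta(s))\Big)\,ds .$$ Let $\mathcal C^N$ be the set of $\tau\in C^1([a,b])\setminus\{0\}$ with $\tau'(a)=\tau'(b)=0$, and $\mathcal D^N=\mathcal C^N\cap C^2([a,b])$. A function $\theta\in C^1([a,b])$ is called stationary (for free boundaries) if $\frac{d}{d\varepsilon}\mathscr E[\theta+\varepsilon\tau]\big|_{\varepsilon=0}=0$ for all $\tau\in\mathcal C^N$. For a class $X$ of nonzero perturbations, $\theta$ is called locally minimal (stable) with respect to $X$ if for every $\tau\in X$ there is $M>0$ such that $\mathscr E[\theta+\varepsilon\tau]>\mathscr E[\theta]$ for all $\varepsilon\in[-M,M]\setminus\{0\}$. Let $\theta$ be stationary and let $X$ be any one of $C^1([a,b])\setminus\{0\}$, $\mathcal C^N$, $\mathcal D^N$. (1) Suppose that $V'(\theta(a))\neq0$, that $V'(\theta(b))\neq0$, and that there is no $s\in[a,b]$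 with $\theta'(s)=0$ and $V'(\theta(s))=0$. If the number $I[\gamma]$ of points $s\in[a,b]$ with $\theta'(s)=0$, that is, the number of times at which the phase plane trajectory $\gamma(s)=(\theta(s),\theta'(s))$ meets the horizontal axis, is at least $2$, then $\theta$ is not locally minimal with respect to $X$. (2) If $A=0$ and $\theta$ is locally minimal with respect to $X$, then $\theta$ is constant on $[a,b]$, and its value is a nondegenerate maximum point $C$ of $V$, that is, $V'(C)=0$ and $V''(C)<0$. -/

import Mathlib

open Set

noncomputable section

/-- The derivative `θ'` on `[a,b]` (one-sided at the two ends) of a function `θ : [a,b] → ℝ`.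
Functions on `[a,b]` are represented by functions `ℝ → ℝ`, of which only the values on `[a,b]`
play a role. -/
def derivOn (a b : ℝ) (θ : ℝ → ℝ) (s : ℝ) : ℝ :=
  derivWithin θ (Icc a b) s

/-- The functional `𝓔[θ] = ∫_a^b ((θ' - A)² / 2 - V(θ)) ds`. -/
def energy (V : ℝ → ℝ) (A a b : ℝ) (θ : ℝ → ℝ) : ℝ :=
  ∫ s in a..b, ((derivOn a b θ s - A) ^ 2 / 2 - V (θ s))

/-- `C¹([a,b]) \ {0}`: all perturbations. -/
def pertC1 (a b : ℝ) : Set (ℝ → ℝ) :=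
  {τ | ContDiffOn ℝ 1 τ (Icc a b) ∧ ∃ s ∈ Icc a b, τ s ≠ 0}

/-- `𝒞ᴺ([a,b])`: nonzero `C¹` perturbations with `τ'(a) = τ'(b) = 0`. -/
def pertCN (a b : ℝ) : Set (ℝ → ℝ) :=
  {τ | ContDiffOn ℝ 1 τ (Icc a b) ∧ derivOn a b τ a = 0 ∧ derivOn a b τ b = 0 ∧
    ∃ s ∈ Icc a b, τ s ≠ 0}

/-- `𝒟ᴺ([a,b])`: nonzero `C²` perturbations with `τ'(a) = τ'(b) = 0`. -/
def pertDN (a b : ℝ) : Set (ℝ → ℝ) :=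
  {τ | ContDiffOn ℝ 2 τ (Icc a b) ∧ derivOn a b τ a = 0 ∧ derivOn a b τ b = 0 ∧
    ∃ s ∈ Icc a b, τ s ≠ 0}

/-- `θ ∈ C¹([a,b])` is stationary for the problem with free boundaries: the first variation
`d/dε 𝓔[θ + ε τ]` at `ε = 0` exists and vanishes for every `τ ∈ 𝒞ᴺ([a,b])`. -/
def IsStationaryFree (V : ℝ → ℝ) (A a b : ℝ) (θ : ℝ → ℝ) : Prop :=
  ContDiffOn ℝ 1 θ (Icc a b) ∧
    ∀ τ ∈ pertCN a b, HasDerivAt (fun ε : ℝ => energy V A a b (fun s => θ s + ε * τ s)) 0 0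

/-- `θ` is locally minimal for `𝓔` with respect to the class `X` of perturbations: for every
`τ ∈ X` there is `M > 0` with `𝓔[θ + ε τ] > 𝓔[θ]` for all `ε ∈ [-M, M] \ {0}`. -/
def IsLocallyMinimal (V : ℝ → ℝ) (A a b : ℝ) (X : Set (ℝ → ℝ)) (θ : ℝ → ℝ) : Prop :=
  ∀ τ ∈ X, ∃ M : ℝ, 0 < M ∧ ∀ ε ∈ Icc (-M) M \ {0},
    energy V A a b (fun s => θ s + ε * τ s) > energy V A a b θ

/-- The phase plane trajectory `γ(s) = (θ(s), θ'(s))`. -/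
def trajectory (a b : ℝ) (θ : ℝ → ℝ) (s : ℝ) : ℝ × ℝ :=
  (θ s, derivOn a b θ s)

/-- The horizontal axis `Γ_h` of the phase plane. -/
def horizontalAxis : Set (ℝ × ℝ) :=
  {p | p.2 = 0}

/-- The index `I[γ]`: the number (possibly infinite) of `s ∈ [a,b]` with `γ(s) ∈ Γ_h`. -/
def indexI (a b : ℝ) (γ : ℝ → ℝ × ℝ) : ℕ∞ :=
  {s ∈ Icc a b | γ s ∈ horizontalAxis}.encard

end

/-! At a local minimizer the first variation vanishes, so `θ'' = -V'(θ)` and `θ'(a) = θ'(b) = A`,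
and the second variation `∫ (τ'² - V''(θ) τ²)` is nonnegative. Differentiating the equation shows
that `v = θ'` is a Jacobi field. If `v` vanishes at `s₁ < s₂`, then `v` cut off outside `(s₁, s₂)`
has zero second variation and a corner of slope `θ''(s₁)` at `s₁`; rounding off this corner makes
the second variation negative unless `θ''(s₁) = 0`. Hence `(θ, θ')` passes through an equilibrium
of the phase plane and `θ` is constant, and constant perturbations give `V''(θ) ≤ 0`. -/

open Filter Topology MeasureTheory
open scoped ContDiff

section Calculus

variable {E : Type*} [NormedAddCommGroup E] [NormedSpace ℝ E]

theorem exists_contDiff_eqOn_Icc [CompleteSpace E] {a b : ℝ} (hab : a < b) {f : ℝ → E}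
    (hf : ContDiffOn ℝ 1 f (Icc a b)) : ∃ g : ℝ → E, ContDiff ℝ 1 g ∧ EqOn f g (Icc a b) := by
  have huniq := uniqueDiffOn_Icc hab
  set q : ℝ → E := IccExtend hab.le ((Icc a b).domRestrict (derivWithin f (Icc a b))) with hq
  have hqc : Continuous q :=
    (continuousOn_iff_continuous_domRestrict.1
      (hf.continuousOn_derivWithin huniq le_rfl)).Icc_extend'
  have hderiv (s : ℝ) : HasDerivAt (fun s => f a + ∫ y in a..s, q y) (q s) s :=
    (hqc.integral_hasStrictDerivAt a s).hasDerivAt.const_add _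
  refine ⟨fun s => f a + ∫ y in a..s, q y, contDiff_one_iff_deriv.2
    ⟨fun s => (hderiv s).differentiableAt, by rwa [funext fun s => (hderiv s).deriv]⟩, ?_⟩
  refine eq_of_derivWithin_eq (hf.differentiableOn one_ne_zero)
    (fun s _ => (hderiv s).differentiableAt.differentiableWithinAt) (fun s hs => ?_) (by simp)
  have hs' := Ico_subset_Icc_self hs
  rw [(hderiv s).hasDerivWithinAt.derivWithin (huniq s hs'), hq, IccExtend_of_mem _ _ hs']
  rfl

theorem hasDerivAt_intervalIntegral_of_continuous {F F' : ℝ → ℝ → E} (a b x₀ : ℝ)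
    (hF : ∀ x, Continuous (F x)) (hF' : Continuous (Function.uncurry F'))
    (hderiv : ∀ x s, HasDerivAt (fun y => F y s) (F' x s) x) :
    HasDerivAt (fun x => ∫ s in a..b, F x s) (∫ s in a..b, F' x₀ s) x₀ := by
  obtain ⟨K, hK⟩ := ((isCompact_closedBall x₀ 1).prod
    (isCompact_uIcc (a := a) (b := b))).exists_bound_of_continuousOn hF'.continuousOn
  exact (intervalIntegral.hasDerivAt_integral_of_dominated_loc_of_deriv_le (bound := fun _ => K)
    (Metric.closedBall_mem_nhds x₀ one_pos)
    (Eventually.of_forall fun x => (hF x).aestronglyMeasurable)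
    ((hF x₀).intervalIntegrable _ _)
    (hF'.comp (Continuous.prodMk_right x₀)).aestronglyMeasurable
    (Eventually.of_forall fun t ht x hx => hK (x, t) ⟨hx, uIoc_subset_uIcc ht⟩)
    intervalIntegrable_const (Eventually.of_forall fun t _ x _ => hderiv x t)).2

theorem deriv_deriv_nonneg_of_isLocalMin {f : ℝ → ℝ} {x : ℝ} (hmin : IsLocalMin f x)
    (hf : ContinuousAt f x) : 0 ≤ deriv (deriv f) x := by
  by_contra! hneg
  have hmax : IsLocalMax f x := isLocalMax_of_deriv_deriv_neg hneg hmin.deriv_eq_zero hf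
  have hconst : f =ᶠ[𝓝 x] fun _ => f x := by
    filter_upwards [hmin, hmax] with y h₁ h₂ using le_antisymm h₂ h₁
  have hzero : deriv (deriv f) x = 0 := by simpa using hconst.deriv.deriv_eq
  exact hneg.ne hzero

theorem integral_indicator_Ioo_of_hasDerivAt [CompleteSpace E] {f f' : ℝ → E} {a s₁ s₂ t : ℝ}
    (ha : a ≤ s₁) (hs : s₁ ≤ s₂) (hat : a ≤ t) (hf : ∀ s ∈ Icc s₁ s₂, HasDerivAt f (f' s) s)
    (hf' : ContinuousOn f' (Icc s₁ s₂)) :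
    ∫ s in a..t, (Ioo s₁ s₂).indicator f' s = f (max s₁ (min t s₂)) - f s₁ := by
  have hsub : uIcc s₁ (max s₁ (min t s₂)) ⊆ Icc s₁ s₂ := by
    rw [uIcc_of_le (le_max_left _ _)]
    exact Icc_subset_Icc_right (max_le hs (min_le_right _ _))
  calc ∫ s in a..t, (Ioo s₁ s₂).indicator f' s
      = ∫ s in Ioc a t, (Ioc s₁ s₂).indicator f' s := by
        rw [intervalIntegral.integral_of_le hat]
        exact integral_congr_ae
          (ae_restrict_of_ae (indicator_ae_eq_of_ae_eq_set Ioo_ae_eq_Ioc))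
    _ = ∫ s in Ioc s₁ (min t s₂), f' s := by
        rw [setIntegral_indicator measurableSet_Ioc, Ioc_inter_Ioc, sup_eq_right.2 ha]
    _ = ∫ s in s₁..max s₁ (min t s₂), f' s := by
        rw [intervalIntegral.integral_of_le (le_max_left _ _)]
        rcases le_total s₁ (min t s₂) with h | h
        · rw [max_eq_right h]
        · rw [max_eq_left h, Ioc_eq_empty h.not_gt, Ioc_self]
    _ = f (max s₁ (min t s₂)) - f s₁ :=
        intervalIntegral.integral_eq_sub_of_hasDerivAt (fun s h => hf s (hsub h))
          (hf'.mono hsub).intervalIntegrable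

theorem integral_indicator_Ioo_of_hasDerivAt_of_eq_zero [CompleteSpace E] {f f' : ℝ → E}
    {a s₁ s₂ t : ℝ} (ha : a ≤ s₁) (hs : s₁ ≤ s₂) (hat : a ≤ t)
    (hf : ∀ s ∈ Icc s₁ s₂, HasDerivAt f (f' s) s) (hf' : ContinuousOn f' (Icc s₁ s₂))
    (hf₁ : f s₁ = 0) (hf₂ : f s₂ = 0) :
    ∫ s in a..t, (Ioo s₁ s₂).indicator f' s = (Ioo s₁ s₂).indicator f t := by
  rw [integral_indicator_Ioo_of_hasDerivAt ha hs hat hf hf', hf₁, sub_zero]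
  rcases le_or_gt t s₁ with h₁ | h₁
  · rw [indicator_of_notMem fun h => h₁.not_gt h.1, min_eq_left (h₁.trans hs), max_eq_left h₁, hf₁]
  rcases lt_or_ge t s₂ with h₂ | h₂
  · rw [indicator_of_mem (mem_Ioo.2 ⟨h₁, h₂⟩), min_eq_left h₂.le, max_eq_right h₁.le]
  · rw [indicator_of_notMem fun h => h₂.not_gt h.2, min_eq_right h₂, max_eq_right hs, hf₂]

theorem exists_contDiff_tendsto_indicator_Ioo {s t : ℝ} (hst : s ≤ t) :
    ∃ χ : ℕ → ℝ → ℝ, (∀ n, ContDiff ℝ ∞ (χ n)) ∧ (∀ n x, |χ n x| ≤ 1) ∧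
      (∀ n, ∀ x ∉ Ioo s t, χ n x = 0) ∧
      ∀ x, Tendsto (fun n => χ n x) atTop (𝓝 ((Ioo s t).indicator 1 x)) := by
  have hzero (n : ℕ) (x : ℝ) (hx : x ∉ Ioo s t) :
      Real.smoothTransition (n * ((x - s) * (t - x))) = 0 := by
    refine Real.smoothTransition.zero_of_nonpos
      (mul_nonpos_of_nonneg_of_nonpos n.cast_nonneg (not_lt.1 fun hpos => hx ?_))
    rcases pos_and_pos_or_neg_and_neg_of_mul_pos hpos with ⟨h₁, h₂⟩ | ⟨h₁, h₂⟩ <;>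
      constructor <;> linarith
  refine ⟨fun n x => Real.smoothTransition (n * ((x - s) * (t - x))),
    fun n => Real.smoothTransition.contDiff.comp (by fun_prop), fun n x => ?_, hzero, fun x => ?_⟩
  · rw [abs_of_nonneg (Real.smoothTransition.nonneg _)]
    exact Real.smoothTransition.le_one _
  · refine tendsto_const_nhds.congr' ?_
    by_cases hx : x ∈ Ioo s t
    · have hpos : 0 < (x - s) * (t - x) := mul_pos (sub_pos.2 hx.1) (sub_pos.2 hx.2)
      filter_upwards [(tendsto_natCast_atTop_atTop.atTop_mul_const hpos).eventually_ge_atTop 1]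
        with n hn
      rw [indicator_of_mem hx, Real.smoothTransition.one_of_one_le hn, Pi.one_apply]
    · exact Eventually.of_forall fun n => by
        simp only [indicator_of_notMem hx, hzero n x hx]

theorem eqOn_const_of_hasDerivAt_of_eq_zero {F : E → E} (hF : LocallyLipschitz F) {γ : ℝ → E}
    {a b t₀ : ℝ} (hγ : ∀ t ∈ Icc a b, HasDerivAt γ (F (γ t)) t) (ht₀ : t₀ ∈ Icc a b)
    (hzero : F (γ t₀) = 0) : EqOn γ (fun _ => γ t₀) (Icc a b) := by
  have hcont : ContinuousOn γ (Icc a b) := HasDerivAt.continuousOn hγ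
  obtain ⟨K, hK⟩ := LocallyLipschitzOn.exists_lipschitzOnWith_of_compact
    (isCompact_Icc.image_of_continuousOn hcont) (hF.locallyLipschitzOn)
  have hleft : Icc a t₀ ⊆ Icc a b := Icc_subset_Icc_right ht₀.2
  have hright : Icc t₀ b ⊆ Icc a b := Icc_subset_Icc_left ht₀.1
  have hconst (t : ℝ) (S : Set ℝ) : HasDerivWithinAt (fun _ => γ t₀) (F (γ t₀)) S t := by
    rw [hzero]
    exact hasDerivWithinAt_const t S _
  rw [← Icc_union_Icc_eq_Icc ht₀.1 ht₀.2]
  refine EqOn.union ?_ ?_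
  · have hsub := Ioc_subset_Icc_self.trans hleft
    exact ODE_solution_unique_of_mem_Icc_left (v := fun _ => F) (fun _ _ => hK)
      (hcont.mono hleft) (fun t ht => (hγ t (hsub ht)).hasDerivWithinAt)
      (fun t ht => mem_image_of_mem γ (hsub ht)) continuousOn_const (fun t _ => hconst t _)
      (fun _ _ => mem_image_of_mem γ ht₀) rfl
  · have hsub := Ico_subset_Icc_self.trans hright
    exact ODE_solution_unique_of_mem_Icc_right (v := fun _ => F) (fun _ _ => hK)
      (hcont.mono hright) (fun t ht => (hγ t (hsub ht)).hasDerivWithinAt)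
      (fun t ht => mem_image_of_mem γ (hsub ht)) continuousOn_const (fun t _ => hconst t _)
      (fun _ _ => mem_image_of_mem γ ht₀) rfl

end Calculus

/-- The function with value `c` at `a` and derivative `r`. Perturbations of `θ` are handled through
the pair `(c, r)`, which makes sense also for piecewise continuous `r`. -/
noncomputable def primitive (a c : ℝ) (r : ℝ → ℝ) (s : ℝ) : ℝ :=
  c + ∫ y in a..s, r y

section Primitive

variable {a b c : ℝ} {r : ℝ → ℝ}

@[simp]
theorem primitive_left (a c : ℝ) (r : ℝ → ℝ) : primitive a c r a = c := by
  simp [primitive]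

theorem hasDerivAt_primitive (hr : Continuous r) (a c s : ℝ) :
    HasDerivAt (primitive a c r) (r s) s :=
  (hr.integral_hasStrictDerivAt a s).hasDerivAt.const_add c

theorem continuous_primitive_of_continuous (hr : Continuous r) (a c : ℝ) :
    Continuous (primitive a c r) :=
  continuous_iff_continuousAt.2 fun s => (hasDerivAt_primitive hr a c s).continuousAt

theorem contDiff_two_primitive (hr : ContDiff ℝ 1 r) (a c : ℝ) :
    ContDiff ℝ 2 (primitive a c r) :=
  (contDiff_succ_iff_deriv (n := 1)).2
    ⟨fun s => (hasDerivAt_primitive hr.continuous a c s).differentiableAt, by simp, by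
      rwa [funext fun s => (hasDerivAt_primitive hr.continuous a c s).deriv]⟩

theorem exists_primitive_ne_zero_eq_zero {s₁ s₂ : ℝ} (ha : a ≤ s₁) (hs : s₁ < s₂) (hb : s₂ ≤ b) :
    ∃ c r, c ≠ 0 ∧ ContDiff ℝ 1 r ∧ r a = 0 ∧ r b = 0 ∧
      primitive a c r s₁ ≠ 0 ∧ primitive a c r s₂ = 0 := by
  set r : ℝ → ℝ := fun s => (s - a) * (b - s) with hr
  have hrd : ContDiff ℝ 1 r := by fun_prop
  have hint (t u : ℝ) : IntervalIntegrable r volume t u := hrd.continuous.intervalIntegrable t u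
  have hpos {t : ℝ} (hat : a ≤ t) (hts : t < s₂) : 0 < ∫ y in t..s₂, r y :=
    intervalIntegral.intervalIntegral_pos_of_pos_on (hint t s₂)
      (fun s hs => mul_pos (sub_pos.2 (hat.trans_lt hs.1)) (sub_pos.2 (hs.2.trans_le hb))) hts
  have hadd := intervalIntegral.integral_add_adjacent_intervals (hint a s₁) (hint s₁ s₂)
  refine ⟨-∫ y in a..s₂, r y, r, neg_ne_zero.2 (hpos le_rfl (ha.trans_lt hs)).ne', hrd,
    by simp [hr], by simp [hr], ?_, neg_add_cancel _⟩
  have hneg : primitive a (-∫ y in a..s₂, r y) r s₁ < 0 := by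
    rw [primitive]
    linarith [hpos ha hs]
  exact hneg.ne

theorem integral_deriv_mul_primitive_add {G g : ℝ → ℝ} (hG : ∀ s, HasDerivAt G (g s) s)
    (hg : Continuous g) (hr : Continuous r) (hGa : G a = 0) (hGb : G b = 0) :
    ∫ s in a..b, (g s * primitive a c r s + G s * r s) = 0 := by
  have hGc : Continuous G := continuous_iff_continuousAt.2 fun s => (hG s).continuousAt
  have hτc := continuous_primitive_of_continuous hr a c
  rw [intervalIntegral.integral_eq_sub_of_hasDerivAt
    (fun s _ => (hG s).mul (hasDerivAt_primitive hr a c s))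
    (Continuous.intervalIntegrable (by fun_prop) a b)]
  simp [hGa, hGb]

/-- The du Bois-Reymond lemma, with free values at both ends. -/
theorem eq_neg_integral_of_forall_integral_eq_zero {m g : ℝ → ℝ} (hab : a < b)
    (hm : Continuous m) (hg : Continuous g)
    (h : ∀ c r, c ≠ 0 → ContDiff ℝ ∞ r → r a = 0 → r b = 0 →
      ∫ s in a..b, (m s * r s - g s * primitive a c r s) = 0) :
    (∀ s ∈ Icc a b, m s = -∫ y in a..s, g y) ∧ ∫ y in a..b, g y = 0 := by
  set G : ℝ → ℝ := fun s => ∫ y in a..s, g y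
  have hG (s : ℝ) : HasDerivAt G (g s) s := (hg.integral_hasStrictDerivAt a s).hasDerivAt
  have hGc : Continuous G := continuous_iff_continuousAt.2 fun s => (hG s).continuousAt
  have hGb : G b = 0 := by
    simpa [primitive] using h 1 (fun _ => 0) one_ne_zero contDiff_const rfl rfl
  refine ⟨fun s hs => eq_neg_of_add_eq_zero_left ?_, hGb⟩
  have hweak (r : ℝ → ℝ) (hr : ContDiff ℝ ∞ r) (hra : r a = 0) (hrb : r b = 0) :
      ∫ s in a..b, r s • (m s + G s) = 0 := by
    have hrc := hr.continuous
    have hτc := continuous_primitive_of_continuous hrc a 1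
    calc ∫ s in a..b, r s • (m s + G s)
        = ∫ s in a..b, ((m s * r s - g s * primitive a 1 r s) +
            (g s * primitive a 1 r s + G s * r s)) := by
          congr with s
          rw [smul_eq_mul]
          ring
      _ = 0 := by
          rw [intervalIntegral.integral_add (Continuous.intervalIntegrable (by fun_prop) a b)
            (Continuous.intervalIntegrable (by fun_prop) a b), h 1 r one_ne_zero hr hra hrb,
            integral_deriv_mul_primitive_add hG hg hrc (by simp [G]) hGb, add_zero]
  have hae : ∀ᵐ s, s ∈ Ioo a b → m s + G s = 0 := by
    refine isOpen_Ioo.ae_eq_zero_of_integral_contDiff_smul_eq_zero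
      ((hm.add hGc).locallyIntegrable.locallyIntegrableOn _) fun r hr _ hsupp => ?_
    have hzero (s : ℝ) (hs : s ∉ Ioo a b) : r s = 0 :=
      image_eq_zero_of_notMem_tsupport fun h => hs (hsupp h)
    rw [← hweak r hr (hzero a (by simp)) (hzero b (by simp)),
      intervalIntegral.integral_of_le hab.le, integral_Ioc_eq_integral_Ioo]
    exact (setIntegral_eq_integral_of_forall_compl_eq_zero fun s hs => by
      rw [hzero s hs, zero_smul]).symm
  refine Measure.eqOn_Icc_of_ae_eq (g := 0) volume hab.ne ?_ (hm.add hGc).continuousOn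
    continuousOn_const hs
  rw [EventuallyEq, ← restrict_Ioo_eq_restrict_Icc, ae_restrict_iff' measurableSet_Ioo]
  exact hae

end Primitive

/-- The quadratic form `∫_a^b (τ'² - p τ²)` at `τ = primitive a c r`; for `p = V'' ∘ θ` it is the
second variation of `𝓔` at `θ`. -/
noncomputable def jacobiForm (p : ℝ → ℝ) (a b c : ℝ) (r : ℝ → ℝ) : ℝ :=
  ∫ s in a..b, (r s ^ 2 - p s * primitive a c r s ^ 2)

section JacobiForm

variable {p : ℝ → ℝ} {a b : ℝ}

theorem tendsto_jacobiForm (hp : Continuous p) (hab : a ≤ b) (c : ℝ) {R : ℕ → ℝ → ℝ} {r : ℝ → ℝ}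
    {K : ℝ} (hR : ∀ n, Continuous (R n)) (hK : ∀ n, ∀ s ∈ Icc a b, |R n s| ≤ K)
    (hlim : ∀ s ∈ Icc a b, Tendsto (fun n => R n s) atTop (𝓝 (r s))) :
    Tendsto (fun n => jacobiForm p a b c (R n)) atTop (𝓝 (jacobiForm p a b c r)) := by
  have hsub {s : ℝ} (hs : s ∈ Icc a b) : uIoc a s ⊆ Icc a b := by
    rw [uIoc_of_le hs.1]
    exact Ioc_subset_Icc_self.trans (Icc_subset_Icc_right hs.2)
  have hK0 : 0 ≤ K := (abs_nonneg _).trans (hK 0 a (left_mem_Icc.2 hab))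
  have hτK (n : ℕ) (s : ℝ) (hs : s ∈ Icc a b) :
      |primitive a c (R n) s| ≤ |c| + K * (b - a) := by
    refine (abs_add_le _ _).trans (add_le_add le_rfl ?_)
    calc |∫ y in a..s, R n y|
        ≤ K * |s - a| := intervalIntegral.norm_integral_le_of_norm_le_const
          (f := R n) (C := K) fun y hy => hK n y (hsub hs hy)
      _ ≤ K * (b - a) := by
          rw [abs_of_nonneg (sub_nonneg.2 hs.1)]
          gcongr
          exact hs.2
  have hτlim (s : ℝ) (hs : s ∈ Icc a b) :
      Tendsto (fun n => primitive a c (R n) s) atTop (𝓝 (primitive a c r s)) :=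
    (intervalIntegral.tendsto_integral_filter_of_dominated_convergence (fun _ => K)
      (Eventually.of_forall fun n => (hR n).aestronglyMeasurable)
      (Eventually.of_forall fun n => Eventually.of_forall fun y hy => hK n y (hsub hs hy))
      intervalIntegrable_const
      (Eventually.of_forall fun y hy => hlim y (hsub hs hy))).const_add c
  have hIcc {s : ℝ} (hs : s ∈ uIoc a b) : s ∈ Icc a b := hsub (right_mem_Icc.2 hab) hs
  refine intervalIntegral.tendsto_integral_filter_of_dominated_convergence
    (fun s => K ^ 2 + |p s| * (|c| + K * (b - a)) ^ 2)
    (Eventually.of_forall fun n => ?_) (Eventually.of_forall fun n => Eventually.of_forall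
      fun s hs => ?_) (Continuous.intervalIntegrable (by fun_prop) a b)
    (Eventually.of_forall fun s hs => ((hlim s (hIcc hs)).pow 2).sub
      (((hτlim s (hIcc hs)).pow 2).const_mul _))
  · have hRn := hR n
    have hτn := continuous_primitive_of_continuous hRn a c
    exact Continuous.aestronglyMeasurable (by fun_prop)
  · refine (norm_sub_le _ _).trans ?_
    rw [norm_mul, norm_pow, norm_pow]
    gcongr
    · exact hK n s (hIcc hs)
    · exact le_rfl
    · exact hτK n s (hIcc hs)

variable {v w : ℝ → ℝ} {s₁ s₂ : ℝ}

theorem primitive_mul_add_indicator_Ioo {ψ : ℝ → ℝ} (hψ : Continuous ψ) (ε k : ℝ)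
    (ha : a ≤ s₁) (hs : s₁ ≤ s₂) (hv : ∀ s ∈ Icc s₁ s₂, HasDerivAt v (w s) s)
    (hw : Continuous w) (hv₁ : v s₁ = 0) (hv₂ : v s₂ = 0) {t : ℝ} (hat : a ≤ t) :
    primitive a (ε * k) (fun s => ε * ψ s + (Ioo s₁ s₂).indicator w s) t =
      ε * primitive a k ψ t + (Ioo s₁ s₂).indicator v t := by
  have hind : IntervalIntegrable ((Ioo s₁ s₂).indicator w) volume a t :=
    intervalIntegrable_iff.2
      ((intervalIntegrable_iff.1 (hw.intervalIntegrable a t)).indicator measurableSet_Ioo)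
  rw [primitive, intervalIntegral.integral_add ((hψ.intervalIntegrable a t).const_mul ε) hind,
    intervalIntegral.integral_const_mul,
    integral_indicator_Ioo_of_hasDerivAt_of_eq_zero ha hs hat hv hw.continuousOn hv₁ hv₂, primitive]
  ring

theorem jacobiForm_mul_add_indicator_Ioo {ψ : ℝ → ℝ} (hp : Continuous p) (hψ : Continuous ψ)
    (ε k : ℝ) (ha : a ≤ s₁) (hs : s₁ ≤ s₂) (hb : s₂ ≤ b)
    (hv : ∀ s ∈ Icc s₁ s₂, HasDerivAt v (w s) s)
    (hw : ∀ s ∈ Icc s₁ s₂, HasDerivAt w (-(p s * v s)) s) (hwc : Continuous w)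
    (hv₁ : v s₁ = 0) (hv₂ : v s₂ = 0) :
    jacobiForm p a b (ε * k) (fun s => ε * ψ s + (Ioo s₁ s₂).indicator w s) =
      ε ^ 2 * jacobiForm p a b k ψ +
        2 * ε * (w s₂ * primitive a k ψ s₂ - w s₁ * primitive a k ψ s₁) := by
  set φ := primitive a k ψ
  have hφ := continuous_primitive_of_continuous hψ a k
  set D : ℝ → ℝ := fun s =>
    2 * ε * (w s * ψ s - p s * v s * φ s) + (w s ^ 2 - p s * v s ^ 2) with hD
  have hDF (s : ℝ) (h : s ∈ Icc s₁ s₂) :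
      HasDerivAt (fun s => 2 * ε * (w s * φ s) + w s * v s) (D s) s :=
    ((((hw s h).mul (hasDerivAt_primitive hψ a k s)).const_mul (2 * ε)).add
      ((hw s h).mul (hv s h))).congr_deriv (by simp only [hD]; ring)
  have hDc : ContinuousOn D (Icc s₁ s₂) := by
    have hvc : ContinuousOn v (Icc s₁ s₂) := HasDerivAt.continuousOn hv
    fun_prop
  have hab : a ≤ b := ha.trans (hs.trans hb)
  have hDi : IntervalIntegrable ((Ioo s₁ s₂).indicator D) volume a b :=
    ((hDc.integrableOn_Icc.mono_set Ioo_subset_Icc_self).integrable_indicator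
      measurableSet_Ioo).intervalIntegrable
  calc jacobiForm p a b (ε * k) (fun s => ε * ψ s + (Ioo s₁ s₂).indicator w s)
      = ∫ s in a..b, (ε ^ 2 * (ψ s ^ 2 - p s * φ s ^ 2) + (Ioo s₁ s₂).indicator D s) := by
        refine intervalIntegral.integral_congr fun s h => ?_
        rw [uIcc_of_le hab] at h
        simp only [primitive_mul_add_indicator_Ioo hψ ε k ha hs hv hwc hv₁ hv₂ h.1]
        by_cases hmem : s ∈ Ioo s₁ s₂
        · simp only [indicator_of_mem hmem, hD]
          ring
        · simp only [indicator_of_notMem hmem]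
          ring
    _ = ε ^ 2 * jacobiForm p a b k ψ + ∫ s in a..b, (Ioo s₁ s₂).indicator D s := by
        rw [intervalIntegral.integral_add (Continuous.intervalIntegrable (by fun_prop) a b) hDi,
          intervalIntegral.integral_const_mul, jacobiForm]
    _ = ε ^ 2 * jacobiForm p a b k ψ + 2 * ε * (w s₂ * φ s₂ - w s₁ * φ s₁) := by
        rw [integral_indicator_Ioo_of_hasDerivAt ha hs hab hDF hDc, min_eq_right hb,
          max_eq_right hs, hv₁, hv₂]
        ring

theorem jacobiForm_mul_add_indicator_Ioo_nonneg {ψ : ℝ → ℝ} (hp : Continuous p)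
    (hψ : ContDiff ℝ 1 ψ) (hψa : ψ a = 0) (hψb : ψ b = 0) (hw : ContDiff ℝ 1 w)
    (ha : a ≤ s₁) (hs : s₁ ≤ s₂) (hb : s₂ ≤ b) {c : ℝ} (hc : c ≠ 0)
    (hnonneg : ∀ c r, c ≠ 0 → ContDiff ℝ 1 r → r a = 0 → r b = 0 → 0 ≤ jacobiForm p a b c r) :
    0 ≤ jacobiForm p a b c (fun s => ψ s + (Ioo s₁ s₂).indicator w s) := by
  obtain ⟨χ, hχ, hχ1, hχ0, hχlim⟩ := exists_contDiff_tendsto_indicator_Ioo hs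
  have hwc := hw.continuous
  have hψc := hψ.continuous
  obtain ⟨K, hK⟩ := (isCompact_Icc (a := a) (b := b)).exists_bound_of_continuousOn
    (f := fun s => |ψ s| + |w s|) (Continuous.continuousOn (by fun_prop))
  refine ge_of_tendsto' (tendsto_jacobiForm hp (ha.trans (hs.trans hb)) c
    (R := fun n s => ψ s + w s * χ n s) (K := K) (fun n => ?_) (fun n s h => ?_)
    (fun s _ => ?_)) fun n => hnonneg c _ hc ?_ ?_ ?_
  · exact hψc.add (hwc.mul (hχ n).continuous)
  · calc |ψ s + w s * χ n s| ≤ |ψ s| + |w s| * |χ n s| := by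
          rw [← abs_mul]
          exact abs_add_le _ _
      _ ≤ |ψ s| + |w s| := by
          gcongr
          exact mul_le_of_le_one_right (abs_nonneg _) (hχ1 n s)
      _ ≤ K := (le_abs_self _).trans (hK s h)
  · have hmul : (Ioo s₁ s₂).indicator w s = w s * (Ioo s₁ s₂).indicator 1 s := by
      rw [← indicator_mul_right, Pi.one_def]
      simp only [mul_one]
    rw [hmul]
    exact ((hχlim s).const_mul _).const_add _
  · exact hψ.add (hw.mul ((hχ n).of_le (by simp)))
  · rw [hψa, hχ0 n a fun h => ha.not_gt h.1, mul_zero, add_zero]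
  · rw [hψb, hχ0 n b fun h => hb.not_gt h.2, mul_zero, add_zero]

/-- The form vanishes at `v` cut off outside `(s₁, s₂)`. If `w s₁ ≠ 0`, the form becomes negative
after perturbing this function at its corner `s₁`. -/
theorem eq_zero_of_jacobiForm_nonneg (hp : Continuous p) (ha : a ≤ s₁) (hs : s₁ < s₂)
    (hb : s₂ ≤ b) (hv : ∀ s ∈ Icc s₁ s₂, HasDerivAt v (w s) s)
    (hw : ∀ s ∈ Icc s₁ s₂, HasDerivAt w (-(p s * v s)) s) (hwd : ContDiff ℝ 1 w)
    (hv₁ : v s₁ = 0) (hv₂ : v s₂ = 0)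
    (hnonneg : ∀ c r, c ≠ 0 → ContDiff ℝ 1 r → r a = 0 → r b = 0 → 0 ≤ jacobiForm p a b c r) :
    w s₁ = 0 := by
  obtain ⟨k, ψ, hk, hψ, hψa, hψb, hφ₁, hφ₂⟩ := exists_primitive_ne_zero_eq_zero ha hs hb
  set μ := -2 * (w s₁ * primitive a k ψ s₁) with hμ
  have hquad (ε : ℝ) : 0 ≤ jacobiForm p a b k ψ * (ε * ε) + μ * ε + 0 := by
    rcases eq_or_ne ε 0 with rfl | hε
    · simp
    have hexp := jacobiForm_mul_add_indicator_Ioo hp hψ.continuous ε k ha hs.le hb hv hw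
      hwd.continuous hv₁ hv₂
    have hpos := jacobiForm_mul_add_indicator_Ioo_nonneg hp (contDiff_const.mul hψ)
      (mul_eq_zero_of_right ε hψa) (mul_eq_zero_of_right ε hψb) hwd ha hs.le hb
      (mul_ne_zero hε hk) hnonneg
    rw [hexp, hφ₂] at hpos
    linarith
  have hμ0 : μ = 0 := by
    have hdiscrim := discrim_le_zero hquad
    rw [discrim] at hdiscrim
    nlinarith
  simpa [hμ, hφ₁] using hμ0

end JacobiForm

section Variation

variable {V θ Θ τ r : ℝ → ℝ} {A a b c : ℝ} {X : Set (ℝ → ℝ)}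

theorem derivOn_eq_deriv (hab : a < b) (hθ : EqOn θ Θ (Icc a b)) {s : ℝ} (hs : s ∈ Icc a b)
    (hΘ : DifferentiableAt ℝ Θ s) : derivOn a b θ s = deriv Θ s :=
  (derivWithin_congr hθ (hθ hs)).trans (hΘ.derivWithin (uniqueDiffOn_Icc hab s hs))

theorem energy_congr (V : ℝ → ℝ) (A : ℝ) (hab : a ≤ b) (hθ : EqOn θ Θ (Icc a b)) :
    energy V A a b θ = energy V A a b Θ := by
  refine intervalIntegral.integral_congr fun s hs => ?_
  rw [uIcc_of_le hab] at hs
  simp only [derivOn, derivWithin_congr hθ (hθ hs), hθ hs]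

theorem energy_eq_integral_deriv (V : ℝ → ℝ) (A : ℝ) (hab : a < b) (hθ : Differentiable ℝ θ) :
    energy V A a b θ = ∫ s in a..b, ((deriv θ s - A) ^ 2 / 2 - V (θ s)) := by
  refine intervalIntegral.integral_congr fun s hs => ?_
  rw [uIcc_of_le hab.le] at hs
  simp only [derivOn_eq_deriv hab (eqOn_refl θ _) hs (hθ s)]

theorem IsLocallyMinimal.congr (hmin : IsLocallyMinimal V A a b X θ) (hab : a ≤ b)
    (hθ : EqOn θ Θ (Icc a b)) : IsLocallyMinimal V A a b X Θ := by
  intro τ hτ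
  obtain ⟨M, hM, hlt⟩ := hmin τ hτ
  refine ⟨M, hM, fun ε hε => ?_⟩
  rw [← energy_congr V A hab hθ,
    ← energy_congr V A hab fun s hs => congrArg (· + ε * τ s) (hθ hs)]
  exact hlt ε hε

theorem IsLocallyMinimal.isLocalMin (hmin : IsLocallyMinimal V A a b X θ) (hτ : τ ∈ X) :
    IsLocalMin (fun ε : ℝ => energy V A a b (fun s => θ s + ε * τ s)) 0 := by
  obtain ⟨M, hM, hlt⟩ := hmin τ hτ
  filter_upwards [Icc_mem_nhds (neg_lt_zero.2 hM) hM] with ε hε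
  rcases eq_or_ne ε 0 with rfl | hε0
  · exact le_rfl
  · simpa only [zero_mul, add_zero] using (hlt ε ⟨hε, hε0⟩).le

theorem primitive_mem_pertDN (hab : a < b) (hc : c ≠ 0) (hr : ContDiff ℝ 1 r) (ha : r a = 0)
    (hb : r b = 0) : primitive a c r ∈ pertDN a b := by
  have hderiv {s : ℝ} (hs : s ∈ Icc a b) : derivOn a b (primitive a c r) s = r s := by
    have h := hasDerivAt_primitive hr.continuous a c s
    rw [derivOn_eq_deriv hab (eqOn_refl _ _) hs h.differentiableAt, h.deriv]
  have haI := left_mem_Icc.2 hab.le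
  exact ⟨(contDiff_two_primitive hr a c).contDiffOn, (hderiv haI).trans ha,
    (hderiv (right_mem_Icc.2 hab.le)).trans hb, a, haI, by rwa [primitive_left]⟩

theorem pertDN_subset (hX : X = pertC1 a b ∨ X = pertCN a b ∨ X = pertDN a b) :
    pertDN a b ⊆ X := by
  rintro τ ⟨hτ, ha, hb, hne⟩
  have hτ1 := hτ.of_le one_le_two
  rcases hX with rfl | rfl | rfl
  · exact ⟨hτ1, hne⟩
  · exact ⟨hτ1, ha, hb, hne⟩
  · exact ⟨hτ, ha, hb, hne⟩

theorem hasDerivAt_energy_add_mul_primitive (hV : ContDiff ℝ 1 V) (hθ : ContDiff ℝ 1 θ)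
    (hab : a < b) (hr : Continuous r) (A c ε : ℝ) :
    HasDerivAt (fun ε : ℝ => energy V A a b (fun s => θ s + ε * primitive a c r s))
      (∫ s in a..b, ((deriv θ s + ε * r s - A) * r s -
        deriv V (θ s + ε * primitive a c r s) * primitive a c r s)) ε := by
  set τ := primitive a c r
  have hτ (s : ℝ) : HasDerivAt τ (r s) s := hasDerivAt_primitive hr a c s
  have hadd (ε s : ℝ) :
      HasDerivAt (fun s => θ s + ε * τ s) (deriv θ s + ε * r s) s :=
    (hθ.differentiable one_ne_zero s).hasDerivAt.add ((hτ s).const_mul ε)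
  have henergy (ε : ℝ) : energy V A a b (fun s => θ s + ε * τ s) =
      ∫ s in a..b, ((deriv θ s + ε * r s - A) ^ 2 / 2 - V (θ s + ε * τ s)) := by
    rw [energy_eq_integral_deriv V A hab fun s => (hadd ε s).differentiableAt]
    simp only [(hadd ε _).deriv]
  have hτc := continuous_primitive_of_continuous hr a c
  have hθc := hθ.continuous
  have hVc := hV.continuous
  simp only [henergy]
  refine hasDerivAt_intervalIntegral_of_continuous
    (F' := fun ε s => (deriv θ s + ε * r s - A) * r s - deriv V (θ s + ε * τ s) * τ s) a b ε
    (fun x => by fun_prop) (by simp only [Function.uncurry_def]; fun_prop) fun x s => ?_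
  have hvel : HasDerivAt (fun y => deriv θ s + y * r s - A) (r s) x :=
    ((hasDerivAt_mul_const (r s)).const_add _).sub_const A
  have hpos : HasDerivAt (fun y => θ s + y * τ s) (τ s) x :=
    (hasDerivAt_mul_const (τ s)).const_add _
  refine (((hvel.pow 2).div_const 2).sub
    ((hV.differentiable one_ne_zero _).hasDerivAt.comp x hpos)).congr_deriv ?_
  simp only [Nat.cast_ofNat]
  ring

theorem hasDerivAt_firstVariation (hV : ContDiff ℝ 2 V) (hθ : ContDiff ℝ 1 θ) (hr : Continuous r)
    (A a b c : ℝ) :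
    HasDerivAt
      (fun ε : ℝ => ∫ s in a..b, ((deriv θ s + ε * r s - A) * r s -
        deriv V (θ s + ε * primitive a c r s) * primitive a c r s))
      (jacobiForm (fun s => deriv (deriv V) (θ s)) a b c r) 0 := by
  set τ := primitive a c r with hτ
  have hτc := continuous_primitive_of_continuous hr a c
  have hθc := hθ.continuous
  have hV' : ContDiff ℝ 1 (deriv V) := hV.deriv'
  have hV'c := hV'.continuous
  have hderiv := hasDerivAt_intervalIntegral_of_continuous
    (F := fun ε s => (deriv θ s + ε * r s - A) * r s - deriv V (θ s + ε * τ s) * τ s)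
    (F' := fun ε s => r s ^ 2 - deriv (deriv V) (θ s + ε * τ s) * τ s ^ 2) a b 0
    (fun x => by fun_prop) (by simp only [Function.uncurry_def]; fun_prop) fun x s => ?_
  · exact hderiv.congr_deriv (by simp only [zero_mul, add_zero, jacobiForm, hτ])
  have hvel : HasDerivAt (fun y => deriv θ s + y * r s - A) (r s) x :=
    ((hasDerivAt_mul_const (r s)).const_add _).sub_const A
  have hpos : HasDerivAt (fun y => θ s + y * τ s) (τ s) x :=
    (hasDerivAt_mul_const (τ s)).const_add _
  refine ((hvel.mul_const (r s)).sub
    (((hV'.differentiable one_ne_zero _).hasDerivAt.comp x hpos).mul_const (τ s))).congr_deriv ?_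
  ring

theorem IsLocallyMinimal.firstVariation_eq_zero (hmin : IsLocallyMinimal V A a b X θ)
    (hX : pertDN a b ⊆ X) (hV : ContDiff ℝ 1 V) (hθ : ContDiff ℝ 1 θ) (hab : a < b)
    (hc : c ≠ 0) (hr : ContDiff ℝ 1 r) (ha : r a = 0) (hb : r b = 0) :
    ∫ s in a..b, ((deriv θ s - A) * r s - deriv V (θ s) * primitive a c r s) = 0 := by
  have h := (hmin.isLocalMin (hX (primitive_mem_pertDN hab hc hr ha hb))).hasDerivAt_eq_zero
    (hasDerivAt_energy_add_mul_primitive hV hθ hab hr.continuous A c 0)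
  simpa only [zero_mul, add_zero] using h

theorem IsLocallyMinimal.jacobiForm_nonneg (hmin : IsLocallyMinimal V A a b X θ)
    (hX : pertDN a b ⊆ X) (hV : ContDiff ℝ 2 V) (hθ : ContDiff ℝ 1 θ) (hab : a < b)
    (hc : c ≠ 0) (hr : ContDiff ℝ 1 r) (ha : r a = 0) (hb : r b = 0) :
    0 ≤ jacobiForm (fun s => deriv (deriv V) (θ s)) a b c r := by
  have hfirst := hasDerivAt_energy_add_mul_primitive (hV.of_le one_le_two) hθ hab
    hr.continuous A c
  have h := deriv_deriv_nonneg_of_isLocalMin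
    (hmin.isLocalMin (hX (primitive_mem_pertDN hab hc hr ha hb))) (hfirst 0).continuousAt
  rwa [funext fun ε => (hfirst ε).deriv,
    (hasDerivAt_firstVariation hV hθ hr.continuous A a b c).deriv] at h

theorem IsLocallyMinimal.deriv_eq_sub_integral (hmin : IsLocallyMinimal V A a b X θ)
    (hX : pertDN a b ⊆ X) (hV : ContDiff ℝ 1 V) (hθ : ContDiff ℝ 1 θ) (hab : a < b) :
    (∀ s ∈ Icc a b, deriv θ s = A - ∫ y in a..s, deriv V (θ y)) ∧
      ∫ y in a..b, deriv V (θ y) = 0 := by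
  obtain ⟨hint, hzero⟩ := eq_neg_integral_of_forall_integral_eq_zero
    (m := fun s => deriv θ s - A) (g := fun s => deriv V (θ s)) hab
    ((hθ.continuous_deriv le_rfl).sub continuous_const)
    ((hV.continuous_deriv le_rfl).comp hθ.continuous)
    fun c r hc hr ha hb => hmin.firstVariation_eq_zero hX hV hθ hab hc (hr.of_le (by simp)) ha hb
  exact ⟨fun s hs => by linear_combination hint s hs, hzero⟩

theorem IsLocallyMinimal.deriv_left (hmin : IsLocallyMinimal V A a b X θ)
    (hX : pertDN a b ⊆ X) (hV : ContDiff ℝ 1 V) (hθ : ContDiff ℝ 1 θ) (hab : a < b) :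
    deriv θ a = A := by
  simpa using (hmin.deriv_eq_sub_integral hX hV hθ hab).1 a (left_mem_Icc.2 hab.le)

theorem IsLocallyMinimal.deriv_right (hmin : IsLocallyMinimal V A a b X θ)
    (hX : pertDN a b ⊆ X) (hV : ContDiff ℝ 1 V) (hθ : ContDiff ℝ 1 θ) (hab : a < b) :
    deriv θ b = A := by
  obtain ⟨hint, hzero⟩ := hmin.deriv_eq_sub_integral hX hV hθ hab
  rw [hint b (right_mem_Icc.2 hab.le), hzero, sub_zero]

theorem IsLocallyMinimal.eqOn_const_of_deriv_eq_zero (hmin : IsLocallyMinimal V A a b X θ)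
    (hX : pertDN a b ⊆ X) (hV : ContDiff ℝ 2 V) (hθ : ContDiff ℝ 1 θ) {s₁ s₂ : ℝ}
    (hs₁ : s₁ ∈ Icc a b) (hs₂ : s₂ ∈ Icc a b) (hs : s₁ < s₂) (hθ₁ : deriv θ s₁ = 0)
    (hθ₂ : deriv θ s₂ = 0) : deriv V (θ s₁) = 0 ∧ EqOn θ (fun _ => θ s₁) (Icc a b) := by
  have hab : a < b := hs₁.1.trans_lt (hs.trans_le hs₂.2)
  have hV' : ContDiff ℝ 1 (deriv V) := hV.deriv'
  have hf : ContDiff ℝ 1 fun s => deriv V (θ s) := hV'.comp hθ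
  set v : ℝ → ℝ := fun s => A - ∫ y in a..s, deriv V (θ y)
  have hθv : ∀ s ∈ Icc a b, deriv θ s = v s :=
    (hmin.deriv_eq_sub_integral hX (hV.of_le one_le_two) hθ hab).1
  have hθd : ∀ s ∈ Icc a b, HasDerivAt θ (v s) s := fun s hs => by
    rw [← hθv s hs]
    exact (hθ.differentiable one_ne_zero s).hasDerivAt
  have hvd (s : ℝ) : HasDerivAt v (-deriv V (θ s)) s :=
    (hf.continuous.integral_hasStrictDerivAt a s).hasDerivAt.const_sub A
  have hwd : ∀ s ∈ Icc a b,
      HasDerivAt (fun s => -deriv V (θ s)) (-(deriv (deriv V) (θ s) * v s)) s := fun s hs =>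
    ((hV'.differentiable one_ne_zero _).hasDerivAt.comp s (hθd s hs)).neg
  have hsub : Icc s₁ s₂ ⊆ Icc a b := Icc_subset_Icc hs₁.1 hs₂.2
  have hcrit : deriv V (θ s₁) = 0 := neg_eq_zero.1 <|
    eq_zero_of_jacobiForm_nonneg (w := fun s => -deriv V (θ s))
      ((hV'.continuous_deriv le_rfl).comp hθ.continuous) hs₁.1 hs hs₂.2 (fun s _ => hvd s)
      (fun s h => hwd s (hsub h)) hf.neg ((hθv s₁ hs₁).symm.trans hθ₁)
      ((hθv s₂ hs₂).symm.trans hθ₂)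
      fun c r hc hr ha hb => hmin.jacobiForm_nonneg hX hV hθ hab hc hr ha hb
  have hF : ContDiff ℝ 1 fun z : ℝ × ℝ => (z.2, -deriv V z.1) :=
    contDiff_snd.prodMk (hV'.comp contDiff_fst).neg
  have hphase : EqOn (fun s => (θ s, v s)) (fun _ => (θ s₁, v s₁)) (Icc a b) :=
    eqOn_const_of_hasDerivAt_of_eq_zero hF.locallyLipschitz
      (fun s hs => (hθd s hs).prodMk (hvd s)) hs₁ (by simp [← hθv s₁ hs₁, hθ₁, hcrit])
  exact ⟨hcrit, fun s hs => congrArg Prod.fst (hphase hs)⟩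

theorem IsLocallyMinimal.deriv_deriv_nonpos (hmin : IsLocallyMinimal V A a b X θ)
    (hX : pertDN a b ⊆ X) (hV : ContDiff ℝ 2 V) (hθ : ContDiff ℝ 1 θ) (hab : a < b) {C : ℝ}
    (hC : EqOn θ (fun _ => C) (Icc a b)) : deriv (deriv V) C ≤ 0 := by
  have hnonneg := hmin.jacobiForm_nonneg (r := fun _ => 0) hX hV hθ hab one_ne_zero
    contDiff_const rfl rfl
  have hform : jacobiForm (fun s => deriv (deriv V) (θ s)) a b 1 (fun _ => 0) =
      ∫ _ in a..b, -deriv (deriv V) C := by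
    refine intervalIntegral.integral_congr fun s hs => ?_
    rw [uIcc_of_le hab.le] at hs
    simp [primitive, hC hs]
  rw [hform, intervalIntegral.integral_const, smul_eq_mul] at hnonneg
  exact neg_nonneg.1 (nonneg_of_mul_nonneg_right hnonneg (sub_pos.2 hab))

theorem exists_lt_deriv_eq_zero_of_two_le_indexI (hab : a < b) (hθ : EqOn θ Θ (Icc a b))
    (hΘ : Differentiable ℝ Θ) (hI : 2 ≤ indexI a b (trajectory a b θ)) :
    ∃ s₁ ∈ Icc a b, ∃ s₂ ∈ Icc a b, s₁ < s₂ ∧ deriv Θ s₁ = 0 ∧ deriv Θ s₂ = 0 := by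
  have hzero {s : ℝ} (h : s ∈ {s ∈ Icc a b | trajectory a b θ s ∈ horizontalAxis}) :
      deriv Θ s = 0 :=
    (derivOn_eq_deriv hab hθ h.1 (hΘ s)).symm.trans h.2
  obtain ⟨s, t, hs, ht, hne⟩ := one_lt_encard_iff.1 (lt_of_lt_of_le (by norm_num) hI)
  rcases hne.lt_or_gt with h | h
  · exact ⟨s, hs.1, t, ht.1, h, hzero hs, hzero ht⟩
  · exact ⟨t, ht.1, s, hs.1, h, hzero ht, hzero hs⟩

end Variation

theorem corollary1_general {V θ : ℝ → ℝ} {A a b : ℝ} {X : Set (ℝ → ℝ)} (hV : ContDiff ℝ 2 V)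
    (hab : a < b) (hθ : ContDiffOn ℝ 1 θ (Icc a b)) (hX : pertDN a b ⊆ X)
    (hmin : IsLocallyMinimal V A a b X θ) (hI : A = 0 ∨ 2 ≤ indexI a b (trajectory a b θ)) :
    ∃ C : ℝ, deriv V C = 0 ∧ deriv (deriv V) C ≤ 0 ∧ ∀ s ∈ Icc a b, θ s = C := by
  obtain ⟨Θ, hΘ, hEq⟩ := exists_contDiff_eqOn_Icc hab hθ
  replace hmin := hmin.congr hab.le hEq
  obtain ⟨s₁, hs₁, s₂, hs₂, hs, hΘ₁, hΘ₂⟩ :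
      ∃ s₁ ∈ Icc a b, ∃ s₂ ∈ Icc a b, s₁ < s₂ ∧ deriv Θ s₁ = 0 ∧ deriv Θ s₂ = 0 := by
    rcases hI with rfl | hI
    · have hV1 := hV.of_le one_le_two
      exact ⟨a, left_mem_Icc.2 hab.le, b, right_mem_Icc.2 hab.le, hab,
        hmin.deriv_left hX hV1 hΘ hab, hmin.deriv_right hX hV1 hΘ hab⟩
    · exact exists_lt_deriv_eq_zero_of_two_le_indexI hab hEq (hΘ.differentiable one_ne_zero) hI
  obtain ⟨hcrit, hconst⟩ := hmin.eqOn_const_of_deriv_eq_zero hX hV hΘ hs₁ hs₂ hs hΘ₁ hΘ₂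
  exact ⟨Θ s₁, hcrit, hmin.deriv_deriv_nonpos hX hV hΘ hab hconst, hEq.trans hconst⟩

theorem corollary1 (V : ℝ → ℝ) (hV : ContDiff ℝ 2 V)
    (hVnd : ∀ x : ℝ, ¬(deriv V x = 0 ∧ deriv (deriv V) x = 0))
    (A a b : ℝ) (hab : a < b) (θ : ℝ → ℝ) (hθ : IsStationaryFree V A a b θ)
    (X : Set (ℝ → ℝ)) (hX : X = pertC1 a b ∨ X = pertCN a b ∨ X = pertDN a b) :
    (deriv V (θ a) ≠ 0 → deriv V (θ b) ≠ 0 →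
      (¬∃ s ∈ Icc a b, derivOn a b θ s = 0 ∧ deriv V (θ s) = 0) →
      2 ≤ indexI a b (trajectory a b θ) → ¬IsLocallyMinimal V A a b X θ) ∧
    (A = 0 → IsLocallyMinimal V A a b X θ →
      ∃ C : ℝ, deriv V C = 0 ∧ deriv (deriv V) C < 0 ∧ ∀ s ∈ Icc a b, θ s = C) := by
  have hgen := corollary1_general (A := A) hV hab hθ.1 (pertDN_subset hX)
  refine ⟨fun ha _ _ hI hmin => ?_, fun hA hmin => ?_⟩
  · obtain ⟨C, hC, -, hconst⟩ := hgen hmin (.inr hI)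
    exact ha (hconst a (left_mem_Icc.2 hab.le) ▸ hC)
  · obtain ⟨C, hC, hC₂, hconst⟩ := hgen hmin (.inl hA)
    exact ⟨C, hC, hC₂.lt_of_ne fun h => hVnd C ⟨hC, h⟩, hconst⟩
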